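/- Let $\Gamma$ be a finite connected graph that is not complete bipartite, and let $G\leqslant\mathrm{Aut}(\Gamma)$ be transitive on the vertices. Suppose that $G$ is quasiprimitive of type SD or CD on the set of edges. That is, $G$ is faithful on the edges and every nontrivial normal subgroup of $G$ (so $G$ itself) is transitive on them; $G$ has a unique minimal normal subgroup $N$; $N\cong T^k$ for some finite nonabelian simple group $T$ and $k\ge 2$; and the stabiliser in $N$ of an edge is a full diagonal subgroup of $T^k$ (type SD) or a product of at least two full strips whose supports partition $\{1,\dots,k\}$ (type CD). Here a full strip of $T^k$ with support $I\subseteq\{1,\dots,k\}$ is a subgroup that projects isomorphically onto the factors in $I$ and trivially to the others; a full diagonal subgroup is a full strip with support $\{1,\dots,k\}$. Let $e=\{v,w\}$ be an edge and let $\mathcal P$ be the partition of $\{1,\dots,k\}$ (the set of simple direct factors of $N$, on which $G$ acts by conjugation) given by the supports of the full strips of $N_e$. Then the following hold. (1) $\Gamma$ is bipartite, and the index two subgroup $G^+$ of $G$ that fixes the two halves setwise acts faithfully on each half. (2) There is a nontrivial $G^+$-invariant partition $\mathcal P_1$ of $\{1,\dots,k\}$ such that $N_v$ is the product of full strips whose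 supports are the parts of $\mathcal P_1$. (3) There is a nontrivial $G^+$-invariant partition $\mathcal P_2$ of $\{1,\dots,k\}$ such that $N_w$ is the product of full strips whose supports are the parts of $\mathcal P_2$. (4) $\mathcal P_1\vee\mathcal P_2=\mathcal P$ (the finest partition refined by both), and $G$ interchanges $\mathcal P_1$ and $\mathcal P_2$: every element of $G\setminus G^+$ swaps them. (5) $\Gamma$ is isomorphic to the graph yielded by the following construction from $G$, its action on the edges, $\mathcal P_1$ and $\mathcal P_2$. The groups and partitions satisfy the requirements of the construction: $G$ is of type SD or CD, the index two subgroup $G^+$ leaves invariant the two distinct partitions $\mathcal P_1,\mathcal P_2$, these are interchanged by $G$, and $\mathcal P_1\vee\mathcal P_2=\mathcal P$. Change the identification $N\cong T^k$ by an automorphism of $T$ in each coordinate so that $N_e$ consists of all $(t_1,\dots,t_k)$ that are constant on each part of $\mathcal P$, and choose $g\in G_e\setminus G^+$ (such choices exist). Let $N_1\leqslant N$ consist of all $(t_1,\dots,t_k)$ that are constant on each part of $\mathcal P_1$, and let $H=N_G(N_1)$. Then $H$ is core-free in $G$, $g$ does not normalise $H$, $g^2\in H$, and, for all such choices, $\Gamma\cong\mathrm{Cos}(G,H,HgH)$,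 the graph on the right cosets of $H$ in which $Hx$ and $Hy$ are adjacent if and only if $xy^{-1}\in HgH$. -/

import Mathlib

open scoped Pointwise

/-! Graph automorphisms and coset graphs -/

/-- The action of the automorphism group of a graph on its edges; every group of automorphisms
`G ≤ Aut Γ` inherits it (and the action on vertices, which is in Mathlib). -/
instance edgeMulAction {V : Type*} (Γ : SimpleGraph V) : MulAction (Γ ≃g Γ) Γ.edgeSet where
  smul f e := f.mapEdgeSet e
  one_smul e := Subtype.ext (congr_fun Sym2.map_id e.1)
  mul_smul f g e := Subtype.ext (Sym2.map_map (g := ⇑f) (f := ⇑g) e.1).symm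

/-- `Γ` is isomorphic to some complete bipartite graph. -/
def IsCompleteBipartite.{u} {V : Type u} (Γ : SimpleGraph V) : Prop :=
  ∃ A B : Type u, Nonempty (Γ ≃g completeBipartiteGraph A B)

/-- The coset graph `Cos(G, H, HgH)`: its vertices are the cosets of `H`, and the cosets of `x` and
`y` are adjacent iff `x⁻¹ y ∈ HgH`. Groups act on the left here, hence left cosets instead of the
mirror image with right cosets and `x y⁻¹`. When `g² ∈ H` and `g ∉ H` the relation is symmetric
and irreflexive, so `SimpleGraph.fromRel` changes nothing. -/
def cosetGraph {G : Type*} [Group G] (H : Subgroup G) (g : G) : SimpleGraph (G ⧸ H) :=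
  SimpleGraph.fromRel fun a b => ∃ x y : G, a = x ∧ b = y ∧ x⁻¹ * y ∈ DoubleCoset.doubleCoset g H H

/-- The requirements on `(G, H, g)` for forming a coset graph: `H` is core-free, `g` does not
normalise `H`, and `g² ∈ H`. -/
def IsCosetGraphPair {G : Type*} [Group G] (H : Subgroup G) (g : G) : Prop :=
  H.normalCore = ⊥ ∧ g ∉ Subgroup.normalizer (H : Set G) ∧ g ^ 2 ∈ H

/-! Strips. A partition of `{1, …, k}` is an equivalence relation on `Fin k`; one partition refines
another iff `≤` holds between them, so the smallest partition refined by both `P` and `Q` is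
`P ⊔ Q`. -/

/-- The partition has more than one part, and not all of its parts are singletons. -/
def IsNontrivialPartition {ι : Type*} (P : Setoid ι) : Prop := P ≠ ⊥ ∧ P ≠ ⊤

/-- `K ≤ T^ι` is a full strip with support `I`: it projects isomorphically onto the factors in `I`
and trivially to the others. -/
structure IsFullStrip {ι T : Type*} [Group T] (K : Subgroup (ι → T)) (I : Set ι) : Prop where
  injOn : ∀ i ∈ I, Set.InjOn (fun x : ι → T => x i) K
  surjOn : ∀ i ∈ I, ∀ t : T, ∃ x ∈ K, x i = t
  trivial : ∀ i, i ∉ I → ∀ x ∈ K, x i = 1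

/-- `K ≤ T^ι` is the product of full strips whose supports are the parts of `P`. -/
def IsProductOfFullStrips {ι T : Type*} [Group T] (K : Subgroup (ι → T)) (P : Setoid ι) : Prop :=
  ∃ S : Set ι → Subgroup (ι → T),
    (∀ I ∈ P.classes, IsFullStrip (S I) I) ∧ K = ⨆ I ∈ P.classes, S I

/-- `K ≤ T^ι` is a full diagonal subgroup: it projects isomorphically onto every factor. -/
def IsFullDiagonal {ι T : Type*} [Group T] (K : Subgroup (ι → T)) : Prop :=
  IsFullStrip K Set.univ

/-- The product of the straight full strips `{(t, …, t)}` of `T^ι` on the parts of `P`, that is, all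
the functions that are constant on each part of `P`. -/
def straightStrips {ι : Type*} (T : Type*) [Group T] (P : Setoid ι) : Subgroup (ι → T) where
  carrier := {x | ∀ i j, P i j → x i = x j}
  one_mem' _ _ _ := rfl
  mul_mem' hx hy i j h := congr_arg₂ (· * ·) (hx i j h) (hy i j h)
  inv_mem' hx i j h := congr_arg (·⁻¹) (hx i j h)

/-! Quasiprimitive groups of types SD and CD -/

section Types

variable {G : Type*} [Group G] {T : Type*} [Group T] {k : ℕ} {N : Subgroup G}

/-- `N` is a minimal normal subgroup of `G`, and it is the only one. -/
def IsUniqueMinimalNormal (N : Subgroup G) : Prop :=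
  Minimal (fun M : Subgroup G => M.Normal ∧ M ≠ ⊥) N ∧
    ∀ M, Minimal (fun M : Subgroup G => M.Normal ∧ M ≠ ⊥) M → M = N

/-- The image in `T^k` of the stabiliser `N_ω`, under the identification `φ` of `N` with `T^k`. -/
def stabilizerImage {Ω : Type*} [MulAction G Ω] (φ : N ≃* (Fin k → T)) (ω : Ω) :
    Subgroup (Fin k → T) :=
  ((MulAction.stabilizer G ω).subgroupOf N).map φ.toMonoidHom

/-- The simple direct factor `T_i` of `N ≅ T^k`, as a subgroup of `G`. -/
def simpleFactor (φ : N ≃* (Fin k → T)) (i : Fin k) : Subgroup G :=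
  (MonoidHom.mulSingle (fun _ : Fin k => T) i).range.map (N.subtype.comp φ.symm.toMonoidHom)

/-- In its conjugation action on the set of the `k` simple direct factors of `N`, the element `g`
takes the partition `P` to the partition `Q`. -/
def CarriesPartition (φ : N ≃* (Fin k → T)) (g : G) (P Q : Setoid (Fin k)) : Prop :=
  ∃ σ : Equiv.Perm (Fin k),
    (∀ i, (simpleFactor φ i).map (MulAut.conj g).toMonoidHom = simpleFactor φ (σ i)) ∧
      ∀ i j, P i j ↔ Q (σ i) (σ j)

/-- `G` is a quasiprimitive permutation group on `Ω` with a unique minimal normal subgroup `N`, and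
`φ` identifies `N` with `T^k`, where `T` is a finite nonabelian simple group and `k ≥ 2`. -/
structure IsQuasiprimitiveWithSocle (Ω : Type*) [MulAction G Ω] (φ : N ≃* (Fin k → T)) :
    Prop where
  faithful : FaithfulSMul G Ω
  quasiprimitive : MulAction.IsQuasiPreprimitive G Ω
  unique_minimal : IsUniqueMinimalNormal N
  finite : Finite T
  simple : IsSimpleGroup T
  nonabelian : ∃ a b : T, a * b ≠ b * a
  two_le : 2 ≤ k

/-- `G` is quasiprimitive on `Ω` of type SD with socle `N ≅ T^k`: the stabilisers `N_ω` are full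
diagonal subgroups. -/
def IsTypeSD (Ω : Type*) [MulAction G Ω] (φ : N ≃* (Fin k → T)) : Prop :=
  IsQuasiprimitiveWithSocle Ω φ ∧ ∀ ω : Ω, IsFullDiagonal (stabilizerImage φ ω)

/-- `G` is quasiprimitive on `Ω` of type CD with socle `N ≅ T^k`: the stabilisers `N_ω` are products
of at least two full strips, whose supports partition `{1, …, k}`. -/
def IsTypeCD (Ω : Type*) [MulAction G Ω] (φ : N ≃* (Fin k → T)) : Prop :=
  IsQuasiprimitiveWithSocle Ω φ ∧ ∀ ω : Ω, ∃ P : Setoid (Fin k),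
    2 ≤ P.classes.ncard ∧ IsProductOfFullStrips (stabilizerImage φ ω) P

/-! The construction of a graph from a group of type SD or CD and two partitions -/

/-- The input of the construction: a group `G`, quasiprimitive on `Ω` of type SD or CD, a point `ω`,
a subgroup `Gp` of index two, and two distinct `Gp`-invariant partitions `P₁`, `P₂` that are
interchanged by `G`, such that `P₁ ∨ P₂` is the partition given by the supports of the full strips
of `N_ω`. -/
structure IsConstructionInput {Ω : Type*} [MulAction G Ω] (φ : N ≃* (Fin k → T)) (ω : Ω)
    (Gp : Subgroup G) (P₁ P₂ : Setoid (Fin k)) : Prop where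
  type : IsTypeSD Ω φ ∨ IsTypeCD Ω φ
  index_two : Gp.index = 2
  ne : P₁ ≠ P₂
  invariant_left : ∀ g ∈ Gp, CarriesPartition φ g P₁ P₁
  invariant_right : ∀ g ∈ Gp, CarriesPartition φ g P₂ P₂
  interchange : ∀ g, g ∉ Gp → CarriesPartition φ g P₁ P₂ ∧ CarriesPartition φ g P₂ P₁
  supports : IsProductOfFullStrips (stabilizerImage φ ω) (P₁ ⊔ P₂)

/-- Change the identification `N ≅ T^k` by an automorphism of `T` in each coordinate. -/
def changeCoordinates (φ : N ≃* (Fin k → T)) (α : Fin k → (T ≃* T)) : N ≃* (Fin k → T) :=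
  φ.trans (MulEquiv.piCongrRight α)

/-- The choices made in the construction: coordinates for `N` in which `N_ω` is the product of the
straight full strips on the parts of `P`, and an element `g` of `G_ω` outside `Gp`. -/
structure IsConstructionChoice {Ω : Type*} [MulAction G Ω] (φ : N ≃* (Fin k → T)) (ω : Ω)
    (Gp : Subgroup G) (P : Setoid (Fin k)) (α : Fin k → (T ≃* T)) (g : G) : Prop where
  straight : stabilizerImage (changeCoordinates φ α) ω = straightStrips T P
  mem_stabilizer : g ∈ MulAction.stabilizer G ω
  not_mem : g ∉ Gp

/-- The vertex stabiliser `H = N_G(N₁)` of the construction, where `N₁ ≤ N` is the product of the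
straight full strips, in the coordinates `ψ` of `N`, on the parts of `P₁`. -/
def constructionSubgroup (ψ : N ≃* (Fin k → T)) (P₁ : Setoid (Fin k)) : Subgroup G :=
  Subgroup.normalizer
    (((straightStrips T P₁).map (N.subtype.comp ψ.symm.toMonoidHom) : Subgroup G) : Set G)

end Types

/-! ### Straight strips and subgroups of `T^ι` containing the diagonal. -/

section Straight

variable {ι T : Type*} [Group T]

/-! Quasiprimitivity makes `N` transitive on edges. In suitable coordinates `N_e` is a product of
straight strips. Such a group has no subgroup of index two, so `N_e` fixes both ends of `e`, and
`N_e = N_v ∩ N_w` (`straightStrips_le_stabilizerImage`). Thus `N_v` and `N_w` contain the diagonal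
of `T^k`. Any subgroup containing the diagonal is a product of straight strips
(`exists_eq_straightStrips`), which gives `P₁` and `P₂`. An intersection of two such products
belongs to the join of the partitions, so `P₁ ⊔ P₂ = P`.

If `N_v = N_w`, then edge-transitivity and connectedness would make `N_v` fix every vertex; hence
`P₁ ≠ P₂`. Conjugation by `g` permutes the simple factors and takes the partition of a vertex `x` to
that of `g • x` (`carriesPartition_of_smul_eq`). Since `N` normalises each factor, `v` and `w` lie
in different `N`-orbits, and these two orbits are the halves of `Γ`. Elements preserving the halves
fix `P₁` and `P₂`, the others interchange them. The partitions `⊥` and `⊤` are fixed by every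
permutation, so neither can occur.

The pointwise stabilisers of the halves generate a normal subgroup; if it were nontrivial, it would
be edge-transitive and force all cross pairs to be adjacent. Finally, an element normalising `N_v`
fixes `P₁`, so it moves `v` within its `N`-orbit; as `N_v` is self-normalising in `N`, it fixes `v`.
Hence `N_G(N_v) = G_v`, and `Γ` is the coset graph of `G_v` because `Γ` is arc-transitive. -/

theorem eq_one_of_central [IsSimpleGroup T] (hT : ∃ a b : T, a * b ≠ b * a) {a : T}
    (ha : ∀ t, a * t = t * a) : a = 1 := by
  have hmem : a ∈ Subgroup.center T := Subgroup.mem_center_iff.2 fun t => (ha t).symm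
  rcases (inferInstance : (Subgroup.center T).Normal).eq_bot_or_eq_top with h | h
  · rwa [h, Subgroup.mem_bot] at hmem
  · obtain ⟨b, c, hbc⟩ := hT
    have hb : b ∈ Subgroup.center T := h ▸ Subgroup.mem_top b
    exact absurd (Subgroup.mem_center_iff.1 hb c).symm hbc

theorem exists_not_commute [IsSimpleGroup T] (hT : ∃ a b : T, a * b ≠ b * a) {a : T}
    (ha : a ≠ 1) : ∃ t, a * t ≠ t * a := by
  by_contra! h
  exact ha (eq_one_of_central hT h)

open Classical in
/-- The element of `T^ι` that is `t` on the part of `i` in `P` and trivial elsewhere. -/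
noncomputable def partSingle (P : Setoid ι) (i : ι) (t : T) : ι → T :=
  fun j => if P i j then t else 1

theorem partSingle_of_rel {P : Setoid ι} {i j : ι} (h : P i j) (t : T) :
    partSingle P i t j = t := if_pos h

theorem partSingle_of_not_rel {P : Setoid ι} {i j : ι} (h : ¬ P i j) (t : T) :
    partSingle P i t j = 1 := if_neg h

theorem partSingle_self (P : Setoid ι) (i : ι) (t : T) : partSingle P i t i = t :=
  partSingle_of_rel (P.refl i) t

theorem partSingle_mem (P : Setoid ι) (i : ι) (t : T) :
    partSingle P i t ∈ straightStrips T P := by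
  intro j l hjl
  by_cases h : P i j
  · rw [partSingle_of_rel h, partSingle_of_rel (P.trans h hjl)]
  · rw [partSingle_of_not_rel h, partSingle_of_not_rel fun h' => h (P.trans h' (P.symm hjl))]

theorem partSingle_mul (P : Setoid ι) (i : ι) (s t : T) :
    partSingle P i (s * t) = partSingle P i s * partSingle P i t := by
  funext j
  by_cases h : P i j
  · simp [partSingle_of_rel h]
  · simp [partSingle_of_not_rel h]

/-- `partSingle` as a homomorphism. -/
noncomputable def partSingleHom (T : Type*) [Group T] (P : Setoid ι) (i : ι) : T →* (ι → T) :=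
  MonoidHom.mk' (partSingle P i) (partSingle_mul P i)

theorem straightStrips_le_of_partSingle_mem [Finite ι] {P : Setoid ι} {K : Subgroup (ι → T)}
    (h : ∀ i t, partSingle P i t ∈ K) : straightStrips T P ≤ K := by
  classical
  have := Fintype.ofFinite ι
  intro x hx
  -- Truncating `x` to the parts that meet `s` stays in `K`; a new index contributes a factor
  -- `partSingle` only if its part is not yet covered.
  have key : ∀ s : Finset ι, (fun j => if ∃ i ∈ s, P i j then x j else 1) ∈ K := by
    intro s
    induction s using Finset.induction_on with
    | empty => simp only [Finset.notMem_empty, false_and, exists_false, if_false]; exact K.one_mem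
    | insert a s _ ih =>
      by_cases has : ∃ i ∈ s, P i a
      · convert ih using 2 with j
        obtain ⟨i, hi, hia⟩ := has
        refine if_congr ⟨?_, ?_⟩ rfl rfl
        · rintro ⟨l, hl, hlj⟩
          rcases Finset.mem_insert.1 hl with rfl | hl
          · exact ⟨i, hi, P.trans hia hlj⟩
          · exact ⟨l, hl, hlj⟩
        · rintro ⟨l, hl, hlj⟩
          exact ⟨l, Finset.mem_insert_of_mem hl, hlj⟩
      · convert K.mul_mem ih (h a (x a)) using 1
        funext j
        by_cases haj : P a j
        · have h1 : ¬ ∃ i ∈ s, P i j := fun ⟨i, hi, hij⟩ => has ⟨i, hi, P.trans hij (P.symm haj)⟩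
          have h2 : ∃ i ∈ insert a s, P i j := ⟨a, Finset.mem_insert_self a s, haj⟩
          simp only [Pi.mul_apply, partSingle_of_rel haj, if_neg h1, if_pos h2, one_mul]
          exact (hx a j haj).symm
        · have h2 : (∃ i ∈ insert a s, P i j) ↔ ∃ i ∈ s, P i j := by
            simp [haj]
          simp only [Pi.mul_apply, partSingle_of_not_rel haj, mul_one, h2]
  convert key Finset.univ with j
  rw [if_pos ⟨j, Finset.mem_univ j, P.refl j⟩]

theorem straightStrips_le_iff [Nontrivial T] {P Q : Setoid ι} :
    straightStrips T P ≤ straightStrips T Q ↔ Q ≤ P := by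
  refine ⟨fun h i j hij => ?_, fun h x hx i j hij => hx i j (h hij)⟩
  obtain ⟨t, ht⟩ := exists_ne (1 : T)
  by_contra hP
  have := h (partSingle_mem P i t) i j hij
  rw [partSingle_self, partSingle_of_not_rel hP] at this
  exact ht this

theorem straightStrips_injective [Nontrivial T] :
    Function.Injective (straightStrips T : Setoid ι → Subgroup (ι → T)) := fun _ _ h =>
  le_antisymm (straightStrips_le_iff.1 h.ge) (straightStrips_le_iff.1 h.le)

theorem straightStrips_inf (P Q : Setoid ι) :
    straightStrips T P ⊓ straightStrips T Q = straightStrips T (P ⊔ Q) := by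
  ext x
  constructor
  · rintro ⟨h1, h2⟩ i j hij
    have hle : P ⊔ Q ≤ Setoid.ker x := sup_le (fun a b h => h1 a b h) (fun a b h => h2 a b h)
    exact hle hij
  · intro h
    exact ⟨fun i j hij => h i j ((le_sup_left : P ≤ P ⊔ Q) hij),
      fun i j hij => h i j ((le_sup_right : Q ≤ P ⊔ Q) hij)⟩

theorem const_mem_straightStrips (P : Setoid ι) (t : T) :
    (fun _ => t : ι → T) ∈ straightStrips T P := fun _ _ _ => rfl

/-- Automorphisms of `T^ι` need not respect equality of coordinates, but they respect triviality of
coordinates up to a permutation. This criterion therefore lets partitions be transported. -/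
theorem rel_iff_eq_one [Nontrivial T] (P : Setoid ι) (i j : ι) :
    P i j ↔ ∀ x ∈ straightStrips T P, x i = 1 ↔ x j = 1 := by
  refine ⟨fun h x hx => by rw [hx i j h], fun h => ?_⟩
  obtain ⟨t, ht⟩ := exists_ne (1 : T)
  by_contra hP
  have := (h _ (partSingle_mem P i t)).2 (partSingle_of_not_rel hP t)
  rw [partSingle_self] at this
  exact ht this

/-- The product of the straight full strips is its own normaliser. -/
theorem mem_straightStrips_of_conj_mem [IsSimpleGroup T] (hT : ∃ a b : T, a * b ≠ b * a)
    {P : Setoid ι} {x : ι → T}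
    (hx : ∀ y ∈ straightStrips T P, x * y * x⁻¹ ∈ straightStrips T P) :
    x ∈ straightStrips T P := by
  intro i j hij
  have : (x j)⁻¹ * x i = 1 := by
    refine eq_one_of_central hT fun t => ?_
    have h : x i * t * (x i)⁻¹ = x j * t * (x j)⁻¹ := hx _ (const_mem_straightStrips P t) i j hij
    rw [mul_inv_eq_iff_eq_mul] at h
    rw [mul_assoc, h]
    group
  exact (inv_mul_eq_one.1 this).symm

/-- A subgroup of `T^ι` that contains the straight diagonal subgroup is a product of straight full
strips. -/
theorem exists_eq_straightStrips [Finite ι] [IsSimpleGroup T] (hT : ∃ a b : T, a * b ≠ b * a)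
    {K : Subgroup (ι → T)} (hK : ∀ t : T, (fun _ => t) ∈ K) :
    ∃ Q : Setoid ι, K = straightStrips T Q := by
  classical
  have := Fintype.ofFinite ι
  let Q : Setoid ι :=
    { r := fun i j => ∀ x ∈ K, x i = x j
      iseqv := ⟨fun _ _ _ => rfl, fun h x hx => (h x hx).symm,
        fun h h' x hx => (h x hx).trans (h' x hx)⟩ }
  refine ⟨Q, le_antisymm (fun x hx i j hij => hij x hx) ?_⟩
  -- The values at `i` of the elements of `K` that vanish on `s`. Conjugation by the diagonal makes
  -- this normal in `T`, hence `⊥` or `⊤`.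
  let A (i : ι) (s : Finset ι) : Subgroup T :=
    { carrier := {t | ∃ x ∈ K, x i = t ∧ ∀ j ∈ s, x j = 1}
      one_mem' := ⟨1, K.one_mem, rfl, fun _ _ => rfl⟩
      mul_mem' := by
        rintro _ _ ⟨x, hx, rfl, hx'⟩ ⟨y, hy, rfl, hy'⟩
        exact ⟨x * y, K.mul_mem hx hy, rfl, fun j hj => by simp [hx' j hj, hy' j hj]⟩
      inv_mem' := by
        rintro _ ⟨x, hx, rfl, hx'⟩
        exact ⟨x⁻¹, K.inv_mem hx, rfl, fun j hj => by simp [hx' j hj]⟩ }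
  have hnormal (i s) : (A i s).Normal := by
    constructor
    rintro _ ⟨x, hx, rfl, hx'⟩ g
    exact ⟨(fun _ => g) * x * (fun _ => g)⁻¹, K.mul_mem (K.mul_mem (hK g) hx) (K.inv_mem (hK g)),
      rfl, fun j hj => by simp [hx' j hj]⟩
  have htop {i s} (t : T) (ht : t ∈ A i s) (h1 : t ≠ 1) : A i s = ⊤ := by
    refine ((hnormal i s).eq_bot_or_eq_top).resolve_left fun h => ?_
    rw [h, Subgroup.mem_bot] at ht
    exact h1 ht
  have hsingle (i j : ι) (hij : ¬ Q i j) : A i {j} = ⊤ := by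
    have : ∃ x ∈ K, x i ≠ x j := by
      by_contra! h
      exact hij h
    obtain ⟨x, hx, hne⟩ := this
    refine htop (x i * (x j)⁻¹) ⟨x * (fun _ => x j)⁻¹, K.mul_mem hx (K.inv_mem (hK _)), rfl, ?_⟩ ?_
    · simp
    · rwa [Ne, mul_inv_eq_one]
  have hall (i : ι) (s : Finset ι) : (∀ j ∈ s, ¬ Q i j) → A i s = ⊤ := by
    induction s using Finset.induction_on with
    | empty =>
      intro _
      refine eq_top_iff.2 fun t _ => ⟨fun _ => t, hK t, rfl, by simp⟩
    | insert a s _ ih =>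
      intro hs
      obtain ⟨b, c, hbc⟩ := hT
      have hb : b ∈ A i {a} := by
        rw [hsingle i a (hs a (Finset.mem_insert_self a s))]; trivial
      have hc : c ∈ A i s := by
        rw [ih fun j hj => hs j (Finset.mem_insert_of_mem hj)]; trivial
      obtain ⟨x, hx, rfl, hx'⟩ := hb
      obtain ⟨y, hy, rfl, hy'⟩ := hc
      -- The commutator of an element trivial at `a` and one trivial on `s` is trivial on both; its
      -- value at `i` is nontrivial because `b` and `c` do not commute.
      refine htop (x i * y i * (x i)⁻¹ * (y i)⁻¹) ⟨x * y * x⁻¹ * y⁻¹,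
        K.mul_mem (K.mul_mem (K.mul_mem hx hy) (K.inv_mem hx)) (K.inv_mem hy), rfl, ?_⟩ ?_
      · intro j hj
        rcases Finset.mem_insert.1 hj with rfl | hj
        · simp [hx' j (Finset.mem_singleton_self j)]
        · simp [hy' j hj]
      · rwa [Ne, mul_inv_eq_one, mul_inv_eq_iff_eq_mul]
  refine straightStrips_le_of_partSingle_mem fun i t => ?_
  have ht : t ∈ A i (Finset.univ.filter fun j => ¬ Q i j) := by
    rw [hall i _ (by simp)]; trivial
  obtain ⟨x, hx, rfl, hx'⟩ := ht
  convert hx using 1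
  funext j
  by_cases h : Q i j
  · rw [partSingle_of_rel h]
    exact h x hx
  · rw [partSingle_of_not_rel h, hx' j (by simpa using h)]

/-- Products of straight full strips have no subgroup of index two. -/
theorem straightStrips_le_of_sq_mem [Finite ι] [IsSimpleGroup T] (hT : ∃ a b : T, a * b ≠ b * a)
    {P : Setoid ι} {M : Subgroup (ι → T)}
    (hsq : ∀ x ∈ straightStrips T P, x * x ∈ M)
    (hconj : ∀ x ∈ straightStrips T P, ∀ y ∈ M, x * y * x⁻¹ ∈ M) :
    straightStrips T P ≤ M := by
  refine straightStrips_le_of_partSingle_mem fun i => ?_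
  have hn : (M.comap (partSingleHom T P i)).Normal := by
    constructor
    intro s hs t
    rw [Subgroup.mem_comap, map_mul, map_mul, map_inv]
    exact hconj _ (partSingle_mem P i t) _ hs
  -- Otherwise every square in `T` is trivial, and `T` is abelian.
  have hne : M.comap (partSingleHom T P i) ≠ ⊥ := by
    intro h
    have hs : ∀ t : T, t * t = 1 := by
      intro t
      have : t * t ∈ M.comap (partSingleHom T P i) := by
        rw [Subgroup.mem_comap, map_mul]
        exact hsq _ (partSingle_mem P i t)
      rwa [h, Subgroup.mem_bot] at this
    obtain ⟨a, b, hab⟩ := hT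
    have hinv (t : T) : t⁻¹ = t := inv_eq_of_mul_eq_one_left (hs t)
    exact hab (by rw [← hinv (a * b), mul_inv_rev, hinv, hinv])
  intro t
  have : t ∈ M.comap (partSingleHom T P i) := by
    rw [hn.eq_bot_or_eq_top.resolve_left hne]; trivial
  exact this

/-- A product of full strips becomes straight after a change of coordinates. -/
theorem IsProductOfFullStrips.exists_straight [Finite ι] {K : Subgroup (ι → T)} {P : Setoid ι}
    (h : IsProductOfFullStrips K P) :
    ∃ α : ι → (T ≃* T), K.map (MulEquiv.piCongrRight α).toMonoidHom = straightStrips T P := by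
  obtain ⟨S, hS, rfl⟩ := h
  let r (i : ι) : ι := (Quotient.mk P i).out
  have hr (i : ι) : P i (r i) := P.symm (Quotient.mk_out (s := P) i)
  have hr' {i j : ι} (hij : P i j) : r i = r j := by
    change (Quotient.mk P i).out = (Quotient.mk P j).out
    rw [Quotient.sound (s := P) hij]
  let C (i : ι) : Set ι := {x | P x (r i)}
  have hC (i : ι) : C i ∈ P.classes := P.mem_classes (r i)
  -- Both projections of the strip, to `i` and to the representative `r i`, are isomorphisms; `a` is
  -- the transition between them.
  have hα (i : ι) : ∃ a : T ≃* T, ∀ x ∈ S (C i), a (x i) = x (r i) := by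
    have hs := hS _ (hC i)
    let f (j : ι) : S (C i) →* T := (Pi.evalMonoidHom (fun _ : ι => T) j).comp (S (C i)).subtype
    have hf (j : ι) (hj : j ∈ C i) : Function.Bijective (f j) :=
      ⟨fun x y hxy => Subtype.ext (hs.injOn j hj x.2 y.2 hxy), fun t => by
        obtain ⟨x, hx, hxt⟩ := hs.surjOn j hj t
        exact ⟨⟨x, hx⟩, hxt⟩⟩
    refine ⟨(MulEquiv.ofBijective (f i) (hf i (hr i))).symm.trans
      (MulEquiv.ofBijective (f (r i)) (hf _ (P.refl _))), fun x hx => ?_⟩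
    have : (MulEquiv.ofBijective (f i) (hf i (hr i))).symm (x i) = ⟨x, hx⟩ := by
      rw [MulEquiv.symm_apply_eq]; rfl
    rw [MulEquiv.trans_apply, this]
    rfl
  choose α hα using hα
  refine ⟨α, le_antisymm ?_ ?_⟩
  · rw [Subgroup.map_le_iff_le_comap]
    refine iSup₂_le fun I hI x hx i j hij => ?_
    change α i (x i) = α j (x j)
    obtain ⟨a, rfl⟩ := hI
    by_cases hia : P i a
    · have hC' : {x | P x a} = C i := by
        ext y
        exact ⟨fun h => P.trans h (P.trans (P.symm hia) (hr i)),
          fun h => P.trans h (P.trans (P.symm (hr i)) hia)⟩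
      have hCC : C i = C j := by
        change {x | P x (r i)} = {x | P x (r j)}
        rw [hr' hij]
      rw [hC'] at hx
      rw [hα i x hx, hα j x (hCC ▸ hx), hr' hij]
    · have hja : ¬ P j a := fun h => hia (P.trans hij h)
      have hs := hS _ (P.mem_classes a)
      rw [hs.trivial i hia x hx, hs.trivial j hja x hx, map_one, map_one]
  · refine straightStrips_le_of_partSingle_mem fun i t => ?_
    have hs := hS _ (hC i)
    obtain ⟨x, hx, rfl⟩ := hs.surjOn (r i) (P.refl _) t
    refine ⟨x, (le_iSup₂ (f := fun I (_ : I ∈ P.classes) => S I) (C i) (hC i)) hx, ?_⟩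
    funext j
    change α j (x j) = _
    by_cases h : P i j
    · have hCC : C i = C j := by
        change {x | P x (r i)} = {x | P x (r j)}
        rw [hr' h]
      rw [partSingle_of_rel h, hα j x (hCC ▸ hx), hr' h]
    · have hj : j ∉ C i := fun hj => h (P.trans (hr i) (P.symm hj))
      rw [partSingle_of_not_rel h, hs.trivial j hj x hx, map_one]

/-- The strip on a part `I` consists of the elements of `K` that are trivial off `I`. -/
theorem isProductOfFullStrips_of_straight [Finite ι] {K : Subgroup (ι → T)} {P : Setoid ι}
    {α : ι → (T ≃* T)} (h : K.map (MulEquiv.piCongrRight α).toMonoidHom = straightStrips T P) :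
    IsProductOfFullStrips K P := by
  have hK (x : ι → T) : x ∈ K ↔ ∀ i j, P i j → α i (x i) = α j (x j) := by
    rw [← Subgroup.mem_map_iff_mem (f := (MulEquiv.piCongrRight α).toMonoidHom)
      (MulEquiv.piCongrRight α).injective, h]
    rfl
  let S (I : Set ι) : Subgroup (ι → T) := K ⊓
    { carrier := {x | ∀ i, i ∉ I → x i = 1}
      one_mem' := fun _ _ => rfl
      mul_mem' := fun hx hy i hi => by simp [hx i hi, hy i hi]
      inv_mem' := fun hx i hi => by simp [hx i hi] }
  have hpart (i : ι) (t : T) : ∃ x ∈ S {j | P j i}, MulEquiv.piCongrRight α x = partSingle P i t := by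
    have hm : (fun j => (α j).symm (partSingle P i t j)) ∈ K := by
      rw [hK]
      intro a b hab
      simpa using partSingle_mem P i t a b hab
    refine ⟨_, ⟨hm, fun j hj => ?_⟩, ?_⟩
    · rw [partSingle_of_not_rel fun h => hj (P.symm h), map_one]
    · funext j
      simp
  refine ⟨S, ?_, le_antisymm ?_ (iSup₂_le fun I _ => inf_le_left)⟩
  · rintro _ ⟨a, rfl⟩
    refine ⟨fun i hi x hx y hy hxy => ?_, fun i hi t => ?_, fun i hi x hx => hx.2 i hi⟩
    · funext j
      by_cases hj : P j a
      · have hij : P i j := P.trans hi (P.symm hj)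
        apply (α j).injective
        rw [← (hK x).1 hx.1 i j hij, ← (hK y).1 hy.1 i j hij]
        exact congrArg _ hxy
      · rw [hx.2 j hj, hy.2 j hj]
    · obtain ⟨x, hx, hx'⟩ := hpart a (α i t)
      refine ⟨x, hx, (α i).injective ?_⟩
      have := congrFun hx' i
      rwa [partSingle_of_rel (P.symm hi)] at this
  · rw [← Subgroup.map_le_map_iff_of_injective (f := (MulEquiv.piCongrRight α).toMonoidHom)
      (MulEquiv.piCongrRight α).injective, h]
    refine straightStrips_le_of_partSingle_mem fun i t => ?_
    obtain ⟨x, hx, hx'⟩ := hpart i t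
    exact ⟨x, (le_iSup₂ (f := fun I (_ : I ∈ P.classes) => S I) _ (P.mem_classes i)) hx, hx'⟩

end Straight

/-! ### Automorphisms of `T^ι` and the simple direct factors. -/

section Factors

variable {ι T : Type*} [Group T] [DecidableEq ι]

/-- `T` has trivial centre. This describes the vanishing of a coordinate by centralising a factor, a
condition that automorphisms preserve. -/
theorem commute_mulSingle_iff [IsSimpleGroup T] (hT : ∃ a b : T, a * b ≠ b * a)
    (x : ι → T) (i : ι) :
    (∀ y ∈ (MonoidHom.mulSingle (fun _ : ι => T) i).range, x * y = y * x) ↔ x i = 1 := by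
  constructor
  · intro h
    refine eq_one_of_central hT fun t => ?_
    simpa using congrFun (h _ ⟨t, rfl⟩) i
  · rintro h _ ⟨t, rfl⟩
    funext j
    by_cases hj : j = i
    · subst hj
      simp [h]
    · simp [Pi.mulSingle_eq_of_ne hj]

/-- If `x ∈ A` has `x j ≠ 1`, a commutator of `x` with an element of the `j`-th factor is a
nontrivial element of `A` in that factor, and simplicity gives the rest. -/
theorem exists_range_mulSingle_le [IsSimpleGroup T] (hT : ∃ a b : T, a * b ≠ b * a)
    {A : Subgroup (ι → T)} (hn : A.Normal) (hA : A ≠ ⊥) :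
    ∃ j, (MonoidHom.mulSingle (fun _ : ι => T) j).range ≤ A := by
  obtain ⟨x, hx, hx1⟩ := A.ne_bot_iff_exists_ne_one.1 hA |>.elim fun x hx =>
    (⟨x.1, x.2, fun h => hx (Subtype.ext h)⟩ : ∃ x, x ∈ A ∧ x ≠ 1)
  obtain ⟨j, hj⟩ := Function.ne_iff.1 hx1
  obtain ⟨t, ht⟩ := exists_not_commute hT hj
  refine ⟨j, ?_⟩
  have hB : (A.comap (MonoidHom.mulSingle (fun _ : ι => T) j)).Normal := hn.comap _
  have hmem : x j * t * (x j)⁻¹ * t⁻¹ ∈ A.comap (MonoidHom.mulSingle (fun _ : ι => T) j) := by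
    rw [Subgroup.mem_comap]
    have h1 : x * (Pi.mulSingle j t * x⁻¹ * (Pi.mulSingle j t)⁻¹) ∈ A :=
      A.mul_mem hx (hn.conj_mem _ (A.inv_mem hx) _)
    convert h1 using 1
    funext l
    by_cases hl : l = j
    · subst hl
      simp [mul_assoc]
    · simp [Pi.mulSingle_eq_of_ne hl]
  have htop : A.comap (MonoidHom.mulSingle (fun _ : ι => T) j) = ⊤ := by
    refine hB.eq_bot_or_eq_top.resolve_left fun h => ?_
    rw [h, Subgroup.mem_bot, mul_inv_eq_one, mul_inv_eq_iff_eq_mul] at hmem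
    exact ht hmem
  rintro _ ⟨s, rfl⟩
  have : s ∈ A.comap (MonoidHom.mulSingle (fun _ : ι => T) j) := htop ▸ Subgroup.mem_top s
  exact this

theorem range_mulSingle_le_iff [Nontrivial T] {i j : ι} :
    (MonoidHom.mulSingle (fun _ : ι => T) i).range ≤ (MonoidHom.mulSingle (fun _ : ι => T) j).range
      ↔ i = j := by
  refine ⟨fun h => ?_, fun h => h ▸ le_rfl⟩
  obtain ⟨t, ht⟩ := exists_ne (1 : T)
  obtain ⟨s, hs⟩ := h ⟨t, rfl⟩
  by_contra hij
  have := congrFun hs i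
  simp [Pi.mulSingle_eq_of_ne hij] at this
  exact ht this.symm

/-- The automorphisms of `T^ι`, with `T` nonabelian simple, permute the simple direct factors. -/
theorem exists_perm_map_mulSingle [Finite ι] [IsSimpleGroup T] (hT : ∃ a b : T, a * b ≠ b * a)
    (θ : (ι → T) ≃* (ι → T)) :
    ∃ σ : Equiv.Perm ι, ∀ i, (MonoidHom.mulSingle (fun _ : ι => T) i).range.map θ.toMonoidHom =
      (MonoidHom.mulSingle (fun _ : ι => T) (σ i)).range := by
  have hnorm (i : ι) : (MonoidHom.mulSingle (fun _ : ι => T) i).range.Normal := by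
    constructor
    rintro _ ⟨t, rfl⟩ g
    refine ⟨g i * t * (g i)⁻¹, ?_⟩
    funext l
    by_cases hl : l = i
    · subst hl
      simp
    · simp [Pi.mulSingle_eq_of_ne hl]
  have hbot (i : ι) : (MonoidHom.mulSingle (fun _ : ι => T) i).range ≠ ⊥ := by
    obtain ⟨t, ht⟩ := exists_ne (1 : T)
    intro h
    have : (Pi.mulSingle i t : ι → T) ∈ (MonoidHom.mulSingle (fun _ : ι => T) i).range := ⟨t, rfl⟩
    rw [h, Subgroup.mem_bot, Pi.mulSingle_eq_one_iff] at this
    exact ht this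
  have hle (θ : (ι → T) ≃* (ι → T)) (i : ι) : ∃ j, (MonoidHom.mulSingle (fun _ : ι => T) j).range ≤
      (MonoidHom.mulSingle (fun _ : ι => T) i).range.map θ.toMonoidHom := by
    refine exists_range_mulSingle_le hT ((hnorm i).map _ θ.surjective) fun h => hbot i ?_
    exact (Subgroup.map_eq_bot_iff_of_injective _ θ.injective).1 h
  have hback {A B : Subgroup (ι → T)} (h : A ≤ B.map θ.symm.toMonoidHom) :
      A.map θ.toMonoidHom ≤ B := by
    rintro _ ⟨x, hx, rfl⟩
    obtain ⟨y, hy, rfl⟩ := h hx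
    simpa using hy
  have heq (i : ι) : ∃ j, (MonoidHom.mulSingle (fun _ : ι => T) i).range.map θ.toMonoidHom =
      (MonoidHom.mulSingle (fun _ : ι => T) j).range := by
    -- With `T_i` for the `i`-th factor: `θ(T_l) ≤ T_j ≤ θ(T_i)` forces `l = i`, so all three
    -- coincide.
    obtain ⟨j, hj⟩ := hle θ i
    obtain ⟨l, hl⟩ := hle θ.symm j
    have hl' := hback hl
    have : l = i := by
      refine (range_mulSingle_le_iff (T := T)).1 ?_
      exact (Subgroup.map_le_map_iff_of_injective (f := θ.toMonoidHom) θ.injective).1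
        (hl'.trans hj)
    subst this
    exact ⟨j, le_antisymm hl' hj⟩
  choose σ hσ using heq
  have hinj : Function.Injective σ := by
    intro i j hij
    refine (range_mulSingle_le_iff (T := T)).1 ?_
    refine (Subgroup.map_le_map_iff_of_injective (f := θ.toMonoidHom) θ.injective).1 ?_
    rw [hσ i, hσ j, hij]
  exact ⟨Equiv.ofBijective σ (Finite.injective_iff_bijective.1 hinj), hσ⟩

theorem apply_eq_one_iff_of_map_mulSingle [IsSimpleGroup T] (hT : ∃ a b : T, a * b ≠ b * a)
    {θ : (ι → T) ≃* (ι → T)} {i j : ι}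
    (h : (MonoidHom.mulSingle (fun _ : ι => T) i).range.map θ.toMonoidHom =
      (MonoidHom.mulSingle (fun _ : ι => T) j).range) (x : ι → T) :
    θ x j = 1 ↔ x i = 1 := by
  rw [← commute_mulSingle_iff hT, ← commute_mulSingle_iff hT, ← h]
  constructor
  · intro hx y hy
    have := hx (θ y) ⟨y, hy, rfl⟩
    rwa [← map_mul, ← map_mul, θ.injective.eq_iff] at this
  · rintro hx _ ⟨y, hy, rfl⟩
    change θ x * θ y = θ y * θ x
    rw [← map_mul, ← map_mul, hx y hy]

end Factors

/-! ### Identifications of `N` with `T^k`, and the action of `G` on partitions. -/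

section Coordinates

variable {G : Type*} [Group G] {T : Type*} [Group T] {k : ℕ} {N : Subgroup G}
  {Ω : Type*} [MulAction G Ω]

theorem mem_simpleFactor {φ : N ≃* (Fin k → T)} {i : Fin k} {x : G} :
    x ∈ simpleFactor φ i ↔ ∃ t : T, (φ.symm (Pi.mulSingle i t) : G) = x := by
  constructor
  · rintro ⟨_, ⟨t, rfl⟩, rfl⟩
    exact ⟨t, rfl⟩
  · rintro ⟨t, rfl⟩
    exact ⟨_, ⟨t, rfl⟩, rfl⟩

theorem simpleFactor_changeCoordinates (φ : N ≃* (Fin k → T)) (α : Fin k → (T ≃* T)) (i : Fin k) :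
    simpleFactor (changeCoordinates φ α) i = simpleFactor φ i := by
  have h (t : T) : (changeCoordinates φ α).symm (Pi.mulSingle i t) =
      φ.symm (Pi.mulSingle i ((α i).symm t)) := by
    rw [MulEquiv.symm_apply_eq]
    funext j
    change _ = α j (φ (φ.symm _) j)
    rw [MulEquiv.apply_symm_apply]
    by_cases hj : j = i
    · subst hj
      simp
    · simp [Pi.mulSingle_eq_of_ne hj]
  ext x
  rw [mem_simpleFactor, mem_simpleFactor]
  constructor
  · rintro ⟨t, rfl⟩
    exact ⟨(α i).symm t, by rw [h]⟩
  · rintro ⟨t, rfl⟩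
    exact ⟨α i t, by rw [h, MulEquiv.symm_apply_apply]⟩

theorem carriesPartition_changeCoordinates {φ : N ≃* (Fin k → T)} {α : Fin k → (T ≃* T)} {g : G}
    {P Q : Setoid (Fin k)} :
    CarriesPartition (changeCoordinates φ α) g P Q ↔ CarriesPartition φ g P Q := by
  simp only [CarriesPartition, simpleFactor_changeCoordinates]

theorem mem_stabilizerImage {φ : N ≃* (Fin k → T)} {ω : Ω} {x : Fin k → T} :
    x ∈ stabilizerImage φ ω ↔ (φ.symm x : G) • ω = ω := by
  constructor
  · rintro ⟨n, hn, rfl⟩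
    change ((φ.symm (φ n) : N) : G) • ω = ω
    rw [MulEquiv.symm_apply_apply]
    exact hn
  · intro h
    exact ⟨φ.symm x, h, φ.apply_symm_apply x⟩

theorem apply_mem_stabilizerImage {φ : N ≃* (Fin k → T)} {ω : Ω} {n : N} :
    φ n ∈ stabilizerImage φ ω ↔ (n : G) • ω = ω := by
  rw [mem_stabilizerImage, MulEquiv.symm_apply_apply]

theorem stabilizerImage_changeCoordinates (φ : N ≃* (Fin k → T)) (α : Fin k → (T ≃* T)) (ω : Ω) :
    stabilizerImage (changeCoordinates φ α) ω =
      (stabilizerImage φ ω).map (MulEquiv.piCongrRight α).toMonoidHom := by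
  rw [stabilizerImage, stabilizerImage, Subgroup.map_map]
  rfl

theorem simpleFactor_injective [Nontrivial T] (φ : N ≃* (Fin k → T)) :
    Function.Injective (simpleFactor φ) := by
  intro i j h
  obtain ⟨t, ht⟩ := exists_ne (1 : T)
  have hm : (φ.symm (Pi.mulSingle i t) : G) ∈ simpleFactor φ j := h ▸ mem_simpleFactor.2 ⟨t, rfl⟩
  obtain ⟨s, hs⟩ := mem_simpleFactor.1 hm
  have hs' : (Pi.mulSingle j s : Fin k → T) = Pi.mulSingle i t :=
    φ.symm.injective (Subtype.ext hs)
  by_contra hij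
  have := congrFun hs' i
  rw [Pi.mulSingle_eq_same, Pi.mulSingle_eq_of_ne hij] at this
  exact ht this.symm

/-- The simple factors are pairwise distinct, so `g` determines the permutation. -/
theorem CarriesPartition.unique [Nontrivial T] {φ : N ≃* (Fin k → T)} {g : G}
    {P Q R : Setoid (Fin k)} (h : CarriesPartition φ g P Q) (h' : CarriesPartition φ g P R) :
    Q = R := by
  obtain ⟨σ, hσ, hPQ⟩ := h
  obtain ⟨τ, hτ, hPR⟩ := h'
  have : σ = τ := Equiv.ext fun i => simpleFactor_injective φ (by rw [← hσ, hτ])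
  subst this
  ext i j
  have h1 := hPQ (σ.symm i) (σ.symm j)
  have h2 := hPR (σ.symm i) (σ.symm j)
  simp only [Equiv.apply_symm_apply] at h1 h2
  exact h1.symm.trans h2

theorem CarriesPartition.mul {φ : N ≃* (Fin k → T)} {g h : G} {P Q R : Setoid (Fin k)}
    (hg : CarriesPartition φ g P Q) (hh : CarriesPartition φ h Q R) :
    CarriesPartition φ (h * g) P R := by
  obtain ⟨σ, hσ, hPQ⟩ := hg
  obtain ⟨τ, hτ, hQR⟩ := hh
  refine ⟨σ.trans τ, fun i => ?_, fun i j => (hPQ i j).trans (hQR _ _)⟩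
  rw [Equiv.trans_apply, ← hτ, ← hσ, Subgroup.map_map]
  congr 1
  ext x
  simp

theorem carriesPartition_of_mem {φ : N ≃* (Fin k → T)} {n : G} (hn : n ∈ N) (P : Setoid (Fin k)) :
    CarriesPartition φ n P P := by
  have key (m : N) (i : Fin k) : (simpleFactor φ i).map (MulAut.conj (m : G)).toMonoidHom ≤
      simpleFactor φ i := by
    rintro _ ⟨x, hx, rfl⟩
    obtain ⟨t, rfl⟩ := mem_simpleFactor.1 hx
    refine mem_simpleFactor.2 ⟨φ m i * t * (φ m i)⁻¹, ?_⟩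
    change _ = ((m * φ.symm (Pi.mulSingle i t) * m⁻¹ : N) : G)
    congr 1
    rw [MulEquiv.symm_apply_eq, map_mul, map_mul, map_inv, MulEquiv.apply_symm_apply]
    funext j
    by_cases hj : j = i
    · subst hj
      simp
    · simp [Pi.mulSingle_eq_of_ne hj]
  refine ⟨1, fun i => le_antisymm (key ⟨n, hn⟩ i) fun x hx => ?_, fun _ _ => Iff.rfl⟩
  refine ⟨n⁻¹ * x * n, ?_, by simp [mul_assoc]⟩
  have := key ⟨n, hn⟩⁻¹ i ⟨x, hx, rfl⟩
  simpa using this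

/-- Conjugation by `g` is an automorphism of `T^k` taking `N_{ω₁}` to `N_{ω₂}`. It permutes the
factors, and the patterns of vanishing coordinates on the stabilisers determine the partitions. -/
theorem carriesPartition_of_smul_eq [N.Normal] [IsSimpleGroup T] (hT : ∃ a b : T, a * b ≠ b * a)
    {ψ : N ≃* (Fin k → T)} {g : G} {ω₁ ω₂ : Ω} (hg : g • ω₁ = ω₂) {Q₁ Q₂ : Setoid (Fin k)}
    (h₁ : stabilizerImage ψ ω₁ = straightStrips T Q₁)
    (h₂ : stabilizerImage ψ ω₂ = straightStrips T Q₂) : CarriesPartition ψ g Q₁ Q₂ := by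
  let θ : (Fin k → T) ≃* (Fin k → T) := (ψ.symm.trans (MulAut.conjNormal g)).trans ψ
  have hθ (x : Fin k → T) : (ψ.symm (θ x) : G) = g * ψ.symm x * g⁻¹ := by
    change (ψ.symm (ψ (MulAut.conjNormal g (ψ.symm x))) : G) = _
    rw [MulEquiv.symm_apply_apply, MulAut.conjNormal_apply]
  have hmem (x : Fin k → T) : θ x ∈ straightStrips T Q₂ ↔ x ∈ straightStrips T Q₁ := by
    rw [← h₁, ← h₂, mem_stabilizerImage, mem_stabilizerImage, hθ, ← hg, mul_smul, mul_smul,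
      inv_smul_smul]
    exact (MulAction.injective g).eq_iff
  obtain ⟨σ, hσ⟩ := exists_perm_map_mulSingle hT θ
  refine ⟨σ, fun i => ?_, fun i j => ?_⟩
  · have hx (t : T) : ∃ s : T, θ (Pi.mulSingle i t) = Pi.mulSingle (σ i) s := by
      have : θ (Pi.mulSingle i t) ∈ (MonoidHom.mulSingle (fun _ : Fin k => T) (σ i)).range :=
        hσ i ▸ ⟨_, ⟨t, rfl⟩, rfl⟩
      obtain ⟨s, hs⟩ := this
      exact ⟨s, hs.symm⟩
    have hy (s : T) : ∃ t : T, θ (Pi.mulSingle i t) = Pi.mulSingle (σ i) s := by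
      have : Pi.mulSingle (σ i) s ∈ (MonoidHom.mulSingle (fun _ : Fin k => T) i).range.map
          θ.toMonoidHom := hσ i ▸ ⟨s, rfl⟩
      obtain ⟨_, ⟨t, rfl⟩, ht⟩ := this
      exact ⟨t, ht⟩
    ext x
    constructor
    · rintro ⟨y, hy, rfl⟩
      obtain ⟨t, rfl⟩ := mem_simpleFactor.1 hy
      obtain ⟨s, hs⟩ := hx t
      exact mem_simpleFactor.2 ⟨s, by rw [← hs, hθ]; rfl⟩
    · intro h
      obtain ⟨s, rfl⟩ := mem_simpleFactor.1 h
      obtain ⟨t, ht⟩ := hy s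
      exact ⟨_, mem_simpleFactor.2 ⟨t, rfl⟩, by rw [← ht, hθ]; rfl⟩
  · rw [rel_iff_eq_one (T := T) Q₁, rel_iff_eq_one (T := T) Q₂]
    constructor
    · intro h y hy
      obtain ⟨x, rfl⟩ := θ.surjective y
      rw [apply_eq_one_iff_of_map_mulSingle hT (hσ i), apply_eq_one_iff_of_map_mulSingle hT (hσ j)]
      exact h x ((hmem x).1 hy)
    · intro h x hx
      rw [← apply_eq_one_iff_of_map_mulSingle hT (hσ i),
        ← apply_eq_one_iff_of_map_mulSingle hT (hσ j)]
      exact h _ ((hmem x).2 hx)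

theorem CarriesPartition.eq_bot {φ : N ≃* (Fin k → T)} {g : G} {Q : Setoid (Fin k)}
    (h : CarriesPartition φ g ⊥ Q) : Q = ⊥ := by
  obtain ⟨σ, -, hσ⟩ := h
  refine eq_bot_iff.2 fun i j hij => ?_
  have := (hσ (σ.symm i) (σ.symm j)).2 (by simpa using hij)
  exact σ.symm.injective this

theorem CarriesPartition.eq_top {φ : N ≃* (Fin k → T)} {g : G} {Q : Setoid (Fin k)}
    (h : CarriesPartition φ g ⊤ Q) : Q = ⊤ := by
  obtain ⟨σ, -, hσ⟩ := h
  refine eq_top_iff.2 fun i j _ => ?_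
  have := (hσ (σ.symm i) (σ.symm j)).1 trivial
  simpa using this

/-- Quasiprimitivity speaks of normal subgroups that act nontrivially; faithfulness turns this into
`M ≠ ⊥`. -/
theorem isPretransitive_of_ne_bot {M : Subgroup G} [FaithfulSMul G Ω]
    [MulAction.IsQuasiPreprimitive G Ω] (hM : M.Normal) (hne : M ≠ ⊥) :
    MulAction.IsPretransitive M Ω := by
  refine MulAction.IsQuasiPreprimitive.isPretransitive_of_normal fun h => hne ?_
  refine (Subgroup.eq_bot_iff_forall _).2 fun m hm => ?_
  refine FaithfulSMul.eq_of_smul_eq_smul (α := Ω) fun ω => ?_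
  have : ω ∈ MulAction.fixedPoints M Ω := h ▸ Set.mem_univ ω
  rw [one_smul]
  exact this ⟨m, hm⟩

/-- The normaliser of a point stabiliser in the socle is the full point stabiliser, if it moves
the point within its orbit under the socle. -/
theorem constructionSubgroup_eq_stabilizer [N.Normal] [IsSimpleGroup T]
    (hT : ∃ a b : T, a * b ≠ b * a) {ψ : N ≃* (Fin k → T)} {ω : Ω} {Q : Setoid (Fin k)}
    (hQ : stabilizerImage ψ ω = straightStrips T Q)
    (horbit : ∀ g : G, CarriesPartition ψ g Q Q → ∃ n ∈ N, g • ω = n • ω) :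
    constructionSubgroup ψ Q = MulAction.stabilizer G ω := by
  have hN₁ (x : G) : x ∈ (straightStrips T Q).map (N.subtype.comp ψ.symm.toMonoidHom) ↔
      x ∈ N ∧ x • ω = ω := by
    constructor
    · rintro ⟨y, hy, rfl⟩
      exact ⟨(ψ.symm y).2, mem_stabilizerImage.1 (hQ ▸ hy)⟩
    · rintro ⟨hx, hω⟩
      refine ⟨ψ ⟨x, hx⟩, ?_, ?_⟩
      · change ψ ⟨x, hx⟩ ∈ straightStrips T Q
        rw [← hQ, apply_mem_stabilizerImage]
        exact hω
      · change ((ψ.symm (ψ ⟨x, hx⟩) : N) : G) = x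
        rw [MulEquiv.symm_apply_apply]
  have hnormal : N.Normal := inferInstance
  have hconj (g x : G) : g * x * g⁻¹ ∈ N ↔ x ∈ N := by
    refine ⟨fun h => ?_, fun h => hnormal.conj_mem x h g⟩
    simpa [mul_assoc] using hnormal.conj_mem _ h g⁻¹
  ext g
  rw [constructionSubgroup, Subgroup.mem_normalizer_iff, MulAction.mem_stabilizer_iff]
  simp only [hN₁, hconj]
  constructor
  · intro h
    have hstab : stabilizerImage ψ (g • ω) = straightStrips T Q := by
      rw [← hQ]
      ext x
      rw [mem_stabilizerImage, mem_stabilizerImage]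
      have hx := h (g⁻¹ * ψ.symm x * g)
      have hx' : g⁻¹ * ψ.symm x * g ∈ N := by
        simpa using hnormal.conj_mem _ (ψ.symm x).2 g⁻¹
      simp only [hx', true_and] at hx
      rw [show g * (g⁻¹ * ψ.symm x * g) * g⁻¹ = (ψ.symm x : G) by group] at hx
      rw [← hx, mul_smul, mul_smul, inv_smul_eq_iff]
    -- Since `g • ω` and `ω` have the same stabiliser in `N`, `g` preserves `Q`, so it may be
    -- replaced by some `n ∈ N`; this `n` normalises a self-normalising subgroup.
    obtain ⟨n, hn, hgn⟩ := horbit g (carriesPartition_of_smul_eq hT rfl hQ hstab)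
    rw [hgn] at hstab ⊢
    have : ψ ⟨n, hn⟩ ∈ straightStrips T Q := by
      refine mem_straightStrips_of_conj_mem hT fun y hy => ?_
      obtain ⟨m, rfl⟩ := ψ.surjective y
      rw [← map_inv, ← map_mul, ← map_mul, ← hstab, apply_mem_stabilizerImage]
      rw [← hQ, apply_mem_stabilizerImage] at hy
      change (n * m * n⁻¹) • n • ω = n • ω
      rw [mul_smul, inv_smul_smul, mul_smul, hy]
    rwa [← hQ, apply_mem_stabilizerImage] at this
  · intro h x
    rw [mul_smul, mul_smul, inv_smul_eq_iff.2 h.symm, smul_eq_iff_eq_inv_smul g,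
      inv_smul_eq_iff.2 h.symm]

end Coordinates

/-! ### Groups acting on graphs: halves, coset graphs, stabilisers of adjacent vertices. -/

section Graph

variable {V : Type*} {Γ : SimpleGraph V} {G : Subgroup (Γ ≃g Γ)}

theorem adj_smul_iff (g : G) (x y : V) : Γ.Adj (g • x) (g • y) ↔ Γ.Adj x y :=
  (g : Γ ≃g Γ).map_adj_iff

theorem coe_smul_edge (g : G) (e : Γ.edgeSet) {x y : V} (he : (e : Sym2 V) = s(x, y)) :
    ((g • e : Γ.edgeSet) : Sym2 V) = s(g • x, g • y) := by
  change Sym2.map _ (e : Sym2 V) = _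
  rw [he]
  rfl

theorem smul_edge_eq_iff (g : G) {e f : Γ.edgeSet} {x y v w : V} (he : (e : Sym2 V) = s(x, y))
    (hf : (f : Sym2 V) = s(v, w)) :
    g • e = f ↔ g • x = v ∧ g • y = w ∨ g • x = w ∧ g • y = v := by
  rw [← Subtype.coe_inj, coe_smul_edge g e he, hf, Sym2.eq_iff]

theorem eq_one_of_forall_smul_eq {g : G} (h : ∀ x : V, g • x = x) : g = 1 :=
  Subtype.ext (RelIso.ext h)

theorem exists_smul_eq_of_adj {M : Subgroup G} (hM : MulAction.IsPretransitive M Γ.edgeSet)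
    {v w x y : V} (hvw : Γ.Adj v w) (hxy : Γ.Adj x y) :
    ∃ m ∈ M, m • x = v ∧ m • y = w ∨ m • x = w ∧ m • y = v := by
  obtain ⟨m, hm⟩ := hM.exists_smul_eq ⟨s(x, y), hxy⟩ ⟨s(v, w), hvw⟩
  exact ⟨m.1, m.2, (smul_edge_eq_iff m.1 rfl rfl).1 hm⟩

theorem SimpleGraph.Connected.exists_adj (hconn : Γ.Connected) {v w : V} (hvw : Γ.Adj v w)
    (x : V) : ∃ y, Γ.Adj x y := by
  have : Nontrivial V := ⟨v, w, hvw.ne⟩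
  exact hconn.preconnected.exists_adj_of_nontrivial x

/-- A graph with parts `A`, `B` all of whose cross pairs are adjacent is complete bipartite. -/
theorem isCompleteBipartite_of_forall_adj {A B : Set V} (hbip : Γ.IsBipartiteWith A B)
    (hun : A ∪ B = Set.univ) (hadj : ∀ x ∈ A, ∀ y ∈ B, Γ.Adj x y) : IsCompleteBipartite Γ := by
  classical
  have hB : ∀ x, x ∉ A → x ∈ B := fun x hx =>
    ((Set.ext_iff.1 hun x).2 trivial).resolve_left hx
  have hAB : ∀ x ∈ A, x ∉ B := fun x hx hx' => Set.disjoint_left.1 hbip.disjoint hx hx'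
  refine ⟨A, (Aᶜ : Set V), ⟨RelIso.symm ⟨Equiv.Set.sumCompl A, ?_⟩⟩⟩
  rintro (⟨x, hx⟩ | ⟨x, hx⟩) (⟨y, hy⟩ | ⟨y, hy⟩)
  · simp only [Equiv.Set.sumCompl_apply_inl, completeBipartiteGraph]
    simpa using fun h => (hbip.mem_of_adj h).elim (fun h => hAB y hy h.2) (fun h => hAB x hx h.1)
  · simpa [completeBipartiteGraph] using hadj x hx y (hB y hy)
  · simpa [completeBipartiteGraph] using (hadj y hy x (hB x hx)).symm
  · simp only [Equiv.Set.sumCompl_apply_inr, completeBipartiteGraph]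
    simpa using fun h => (hbip.mem_of_adj h).elim (fun h => hx h.1) (fun h => hy h.2)

/-- If every nontrivial normal subgroup of `G` is transitive on the edges of a bipartite graph that
is not complete bipartite, then the elements that fix a half pointwise are trivial. -/
theorem eq_one_of_fixes_half (hcb : ¬ IsCompleteBipartite Γ)
    (hquasi : ∀ M : Subgroup G, M.Normal → M ≠ ⊥ → MulAction.IsPretransitive M Γ.edgeSet)
    {A B : Set V} (hbip : Γ.IsBipartiteWith A B) (hun : A ∪ B = Set.univ)
    {v w : V} (hvw : Γ.Adj v w) (hv : v ∈ A) (hw : w ∈ B) (hiso : ∀ x, ∃ y, Γ.Adj x y)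
    (hG : ∀ g : G, g • A = A ∧ g • B = B ∨ g • A = B ∧ g • B = A)
    {g : G} (hg : ∀ x ∈ A, g • x = x) : g = 1 := by
  by_contra hg1
  have hAB : ∀ x ∈ A, x ∉ B := fun x hx hx' => Set.disjoint_left.1 hbip.disjoint hx hx'
  have hcov (x : V) : x ∈ A ∨ x ∈ B := (Set.ext_iff.1 hun x).2 trivial
  have hA {x : V} : x ∈ A ↔ x ∉ B := ⟨hAB x, (hcov x).resolve_right⟩
  have hB {x : V} : x ∈ B ↔ x ∉ A := by rw [hA, not_not]
  have fixA {a : G} : a ∈ fixingSubgroup G A ↔ ∀ x ∈ A, a • x = x := mem_fixingSubgroup_iff G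
  have fixB {a : G} : a ∈ fixingSubgroup G B ↔ ∀ x ∈ B, a • x = x := mem_fixingSubgroup_iff G
  have presB {a : G} (ha : a ∈ fixingSubgroup G A) {x : V} (hx : x ∈ B) : a • x ∈ B := by
    rw [hB] at hx ⊢
    intro h
    exact hx (MulAction.injective a (fixA.1 ha _ h) ▸ h)
  have presA {a : G} (ha : a ∈ fixingSubgroup G B) {x : V} (hx : x ∈ A) : a • x ∈ A := by
    rw [hA] at hx ⊢
    intro h
    exact hx (MulAction.injective a (fixB.1 ha _ h) ▸ h)
  -- Each of `a` and `b` moves only points of one half and preserves both halves.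
  have hcomm {a b : G} (ha : a ∈ fixingSubgroup G A) (hb : b ∈ fixingSubgroup G B) :
      a * b = b * a := by
    rw [← mul_inv_eq_one, mul_inv_eq_iff_eq_mul, one_mul, ← inv_mul_eq_one]
    refine eq_one_of_forall_smul_eq fun x => ?_
    rw [mul_smul, inv_smul_eq_iff, mul_smul, mul_smul]
    rcases hcov x with hx | hx
    · rw [fixA.1 ha x hx, fixA.1 ha _ (presA hb hx)]
    · rw [fixB.1 hb x hx, fixB.1 hb _ (presB ha hx)]
  let M : Subgroup G :=
    { carrier := {m | ∃ a ∈ fixingSubgroup G A, ∃ b ∈ fixingSubgroup G B, m = a * b}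
      one_mem' := ⟨1, one_mem _, 1, one_mem _, (one_mul 1).symm⟩
      mul_mem' := by
        rintro _ _ ⟨a, ha, b, hb, rfl⟩ ⟨c, hc, d, hd, rfl⟩
        refine ⟨a * c, mul_mem ha hc, b * d, mul_mem hb hd, ?_⟩
        rw [mul_assoc, ← mul_assoc b, ← hcomm hc hb]
        simp only [mul_assoc]
      inv_mem' := by
        rintro _ ⟨a, ha, b, hb, rfl⟩
        exact ⟨a⁻¹, inv_mem ha, b⁻¹, inv_mem hb, by
          rw [hcomm ha hb, mul_inv_rev]⟩ }
  have hconj {C D : Set V} {c a : G} (hc : c • C = D) (ha : ∀ x ∈ C, a • x = x) :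
      ∀ x ∈ D, (c * a * c⁻¹) • x = x := by
    rintro x hx
    rw [← hc] at hx
    obtain ⟨y, hy, rfl⟩ := hx
    change (c * a * c⁻¹) • c • y = c • y
    rw [mul_smul, inv_smul_smul, mul_smul, ha y hy]
  have hMn : M.Normal := by
    constructor
    rintro _ ⟨a, ha, b, hb, rfl⟩ c
    have e : c * (a * b) * c⁻¹ = (c * a * c⁻¹) * (c * b * c⁻¹) := by group
    rcases hG c with ⟨h1, h2⟩ | ⟨h1, h2⟩
    · exact ⟨_, fixA.2 (hconj h1 (fixA.1 ha)), _, fixB.2 (hconj h2 (fixB.1 hb)), e⟩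
    · refine ⟨_, fixA.2 (hconj h2 (fixB.1 hb)), _, fixB.2 (hconj h1 (fixA.1 ha)), ?_⟩
      rw [hcomm ha hb]
      group
  have hM1 : M ≠ ⊥ := fun h => hg1 <| by
    have : g ∈ M := ⟨g, fixA.2 hg, 1, one_mem _, (mul_one g).symm⟩
    rwa [h, Subgroup.mem_bot] at this
  have htr := hquasi M hMn hM1
  refine hcb (isCompleteBipartite_of_forall_adj hbip hun fun x hx y hy => ?_)
  -- An element of `M` takes `{v, w}` to an edge at `x`. It preserves the halves, so it takes `v` to
  -- `x`, and only its factor fixing `B` acts on `A`.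
  obtain ⟨b, hb, hbx⟩ : ∃ b ∈ fixingSubgroup G B, b • v = x := by
    obtain ⟨z, hz⟩ := hiso x
    have hzB : z ∈ B := (hbip.mem_of_adj hz).elim And.right fun h => absurd h.1 (hAB x hx)
    obtain ⟨_, ⟨a, ha, b, hb, rfl⟩, h⟩ := exists_smul_eq_of_adj htr hz hvw
    have hm : (a * b) • v = b • v := by rw [mul_smul, fixA.1 ha _ (presA hb hv)]
    refine ⟨b, hb, ?_⟩
    rcases h with h | h
    · rw [← hm, h.1]
    · exact absurd hzB (hAB z (h.1 ▸ hm ▸ presA hb hv))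
  obtain ⟨a, ha, hay⟩ : ∃ a ∈ fixingSubgroup G A, a • w = y := by
    obtain ⟨z, hz⟩ := hiso y
    have hzA : z ∈ A := (hbip.mem_of_adj hz).elim (fun h => absurd hy (hAB y h.1)) And.right
    obtain ⟨_, ⟨a, ha, b, hb, rfl⟩, h⟩ := exists_smul_eq_of_adj htr hz.symm hvw
    have hm : (a * b) • w = a • w := by rw [mul_smul, fixB.1 hb _ hw]
    refine ⟨a, ha, ?_⟩
    rcases h with h | h
    · rw [← hm, h.2]
    · exact absurd (h.2 ▸ hm ▸ presB ha hw) (hAB z hzA)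
  have h1 : (a * b) • v = x := by rw [mul_smul, hbx, fixA.1 ha x hx]
  have h2 : (a * b) • w = y := by rw [mul_smul, fixB.1 hb w hw, hay]
  rw [← h1, ← h2, adj_smul_iff]
  exact hvw

/-- An arc-transitive graph is a coset graph. -/
theorem nonempty_iso_cosetGraph [MulAction.IsPretransitive G V] {v w : V} (hvw : Γ.Adj v w)
    {g : G} (hgv : g • v = w)
    (hloc : ∀ u, Γ.Adj v u → ∃ h ∈ MulAction.stabilizer G v, h • w = u) :
    Nonempty (Γ ≃g cosetGraph (MulAction.stabilizer G v) g) := by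
  -- `HgH` is the set of elements taking `v` to a neighbour, because `H` is transitive on the
  -- neighbours of `v`.
  have hD (x : G) : x ∈ DoubleCoset.doubleCoset g (MulAction.stabilizer G v : Set G)
      (MulAction.stabilizer G v : Set G) ↔ Γ.Adj v (x • v) := by
    rw [DoubleCoset.mem_doubleCoset]
    constructor
    · rintro ⟨a, ha, b, hb, rfl⟩
      have ha' : a • v = v := ha
      have hb' : b • v = v := hb
      rw [mul_smul, mul_smul, hb', hgv]
      nth_rw 1 [← ha']
      rwa [adj_smul_iff]
    · intro h
      obtain ⟨a, ha, haw⟩ := hloc _ h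
      refine ⟨a, ha, (a * g)⁻¹ * x, ?_, by group⟩
      change ((a * g)⁻¹ * x) • v = v
      rw [mul_smul, inv_smul_eq_iff, mul_smul, hgv, haw]
  have hR (x y : G) : (∃ a b : G, (x : G ⧸ MulAction.stabilizer G v) = a ∧
      (y : G ⧸ MulAction.stabilizer G v) = b ∧ a⁻¹ * b ∈ DoubleCoset.doubleCoset g
        (MulAction.stabilizer G v : Set G) (MulAction.stabilizer G v : Set G)) ↔
      Γ.Adj (x • v) (y • v) := by
    have hadj (a b : G) : Γ.Adj v ((a⁻¹ * b) • v) ↔ Γ.Adj (a • v) (b • v) := by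
      rw [← adj_smul_iff a, mul_smul, smul_inv_smul]
    have hco {a b : G} (h : (a : G ⧸ MulAction.stabilizer G v) = b) : a • v = b • v := by
      have : (a⁻¹ * b) • v = v := QuotientGroup.eq.1 h
      rw [mul_smul, inv_smul_eq_iff] at this
      exact this.symm
    constructor
    · rintro ⟨a, b, hxa, hyb, h⟩
      rw [hco hxa, hco hyb, ← hadj]
      exact (hD _).1 h
    · intro h
      exact ⟨x, y, rfl, rfl, (hD _).2 ((hadj x y).2 h)⟩
  have hbij : Function.Bijective (MulAction.ofQuotientStabilizer G v) :=
    ⟨MulAction.injective_ofQuotientStabilizer G v, fun x => by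
      obtain ⟨g, rfl⟩ := MulAction.exists_smul_eq G v x
      exact ⟨g, rfl⟩⟩
  refine ⟨RelIso.symm ⟨Equiv.ofBijective _ hbij, ?_⟩⟩
  intro a b
  obtain ⟨x, rfl⟩ := QuotientGroup.mk_surjective a
  obtain ⟨y, rfl⟩ := QuotientGroup.mk_surjective b
  rw [cosetGraph, SimpleGraph.fromRel_adj, hR, hR, Γ.adj_comm (y • v), or_self]
  refine ⟨fun h => ⟨fun hxy => h.ne (congrArg (MulAction.ofQuotientStabilizer G v) hxy), h⟩,
    And.right⟩

variable {N : Subgroup G} {T : Type*} [Group T] {k : ℕ}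

/-- An element of `N_e` fixes or swaps the ends of `e`. So `N_v ∩ N_w` contains all squares from
`N_e` and is normalised by it, and `straightStrips_le_of_sq_mem` applies. -/
theorem straightStrips_le_stabilizerImage [IsSimpleGroup T] (hT : ∃ a b : T, a * b ≠ b * a)
    {ψ : N ≃* (Fin k → T)} {e : Γ.edgeSet} {v w : V} (he : (e : Sym2 V) = s(v, w))
    {P : Setoid (Fin k)} (hP : stabilizerImage ψ e = straightStrips T P) :
    straightStrips T P ≤ stabilizerImage ψ v ⊓ stabilizerImage ψ w := by
  have hmem (x : Fin k → T) : x ∈ straightStrips T P ↔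
      (ψ.symm x : G) • v = v ∧ (ψ.symm x : G) • w = w ∨
        (ψ.symm x : G) • v = w ∧ (ψ.symm x : G) • w = v := by
    rw [← hP, mem_stabilizerImage, smul_edge_eq_iff _ he he]
  refine straightStrips_le_of_sq_mem hT (fun x hx => ?_) fun x hx y hy => ?_
  · rw [Subgroup.mem_inf, mem_stabilizerImage, mem_stabilizerImage, map_mul, Subgroup.coe_mul,
      mul_smul, mul_smul]
    rcases (hmem x).1 hx with ⟨h1, h2⟩ | ⟨h1, h2⟩ <;> simp [h1, h2]
  · rw [Subgroup.mem_inf, mem_stabilizerImage, mem_stabilizerImage] at hy ⊢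
    simp only [map_mul, map_inv, Subgroup.coe_mul, Subgroup.coe_inv, mul_smul, smul_eq_iff_eq_inv_smul
      (ψ.symm x : G)]
    have := (hmem x⁻¹).1 (inv_mem hx)
    rw [map_inv, Subgroup.coe_inv] at this
    rcases this with ⟨h1, h2⟩ | ⟨h1, h2⟩ <;> simp [h1, h2, hy.1, hy.2]

/-- Equality at one edge spreads to all edges by transitivity, then along walks; an element of `N_v`
would fix every vertex. -/
theorem stabilizerImage_ne_of_adj [N.Normal] (hconn : Γ.Connected)
    (htr : MulAction.IsPretransitive N Γ.edgeSet) {ψ : N ≃* (Fin k → T)} {v w : V}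
    (hvw : Γ.Adj v w) (hne : stabilizerImage ψ v ≠ ⊥) :
    stabilizerImage ψ v ≠ stabilizerImage ψ w := by
  intro h
  have hfix (m : G) (hm : m ∈ N) : m • v = v ↔ m • w = w := by
    rw [← apply_mem_stabilizerImage (φ := ψ) (n := ⟨m, hm⟩), h, apply_mem_stabilizerImage]
  have hadj {x y : V} (hxy : Γ.Adj x y) (m : G) (hm : m ∈ N) (hx : m • x = x) : m • y = y := by
    obtain ⟨n, hn, hn'⟩ := exists_smul_eq_of_adj htr hvw hxy
    have hc := hfix (n * m * n⁻¹) ((inferInstance : N.Normal).conj_mem m hm n)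
    have hcz (z : V) : (n * m * n⁻¹) • n • z = n • z ↔ m • z = z := by
      rw [mul_smul, inv_smul_smul, mul_smul]
      exact (MulAction.injective n).eq_iff
    rcases hn' with ⟨h1, h2⟩ | ⟨h1, h2⟩
    · rw [← h1, ← h2, hcz, hcz] at hc
      exact hc.1 hx
    · rw [← h1, ← h2, hcz, hcz] at hc
      exact hc.2 hx
  refine hne ((Subgroup.eq_bot_iff_forall _).2 fun x hx => ?_)
  rw [mem_stabilizerImage] at hx
  have hwalk {a b : V} (p : Γ.Walk a b) : (ψ.symm x : G) • a = a → (ψ.symm x : G) • b = b := by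
    induction p with
    | nil => exact id
    | cons hab _ ih => exact fun ha => ih (hadj hab _ (ψ.symm x).2 ha)
  have hall (y : V) : (ψ.symm x : G) • y = y :=
    (hconn.preconnected v y).elim fun p => hwalk p hx
  have h1 : ψ.symm x = 1 := Subtype.ext (eq_one_of_forall_smul_eq hall)
  rwa [map_eq_one_iff _ ψ.symm.injective] at h1

end Graph

/-! ### Independence of coordinates, and the main theorem. -/

/-- The supports of the strips do not depend on the coordinates that make the strips straight. -/
theorem eq_of_map_eq_straightStrips {ι T : Type*} [Group T] [Nontrivial T]
    {K : Subgroup (ι → T)} {P Q : Setoid ι} {α β : ι → (T ≃* T)}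
    (hα : K.map (MulEquiv.piCongrRight α).toMonoidHom = straightStrips T P)
    (hβ : K.map (MulEquiv.piCongrRight β).toMonoidHom = straightStrips T Q) : P = Q := by
  have key {R : Setoid ι} {γ : ι → (T ≃* T)}
      (h : K.map (MulEquiv.piCongrRight γ).toMonoidHom = straightStrips T R) (i j : ι) :
      R i j ↔ ∀ x ∈ K, x i = 1 ↔ x j = 1 := by
    have hγ (x : ι → T) (l : ι) : (MulEquiv.piCongrRight γ).toMonoidHom x l = 1 ↔ x l = 1 :=
      map_eq_one_iff (γ l) (γ l).injective
    rw [rel_iff_eq_one (T := T), ← h]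
    constructor
    · intro H x hx
      rw [← hγ x i, ← hγ x j]
      exact H _ ⟨x, hx, rfl⟩
    · rintro H _ ⟨x, hx, rfl⟩
      rw [hγ, hγ]
      exact H x hx
  ext i j
  rw [key hα, key hβ]

theorem proposition6 {V : Type*} [Finite V] (Γ : SimpleGraph V) (hconn : Γ.Connected)
    (hcb : ¬ IsCompleteBipartite Γ)
    (G : Subgroup (Γ ≃g Γ)) (hvt : MulAction.IsPretransitive G V)
    (N : Subgroup G) {T : Type*} [Group T] {k : ℕ} (φ : N ≃* (Fin k → T))
    (htype : IsTypeSD Γ.edgeSet φ ∨ IsTypeCD Γ.edgeSet φ)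
    (v w : V) (hvw : Γ.Adj v w) (e : Γ.edgeSet) (he : (e : Sym2 V) = s(v, w))
    (P : Setoid (Fin k)) (hP : IsProductOfFullStrips (stabilizerImage φ e) P) :
    ∃ (Δ₁ Δ₂ : Set V) (Gp : Subgroup G) (P₁ P₂ : Setoid (Fin k)),
      -- `Γ` is bipartite with halves `Δ₁`, `Δ₂`
      (Γ.IsBipartiteWith Δ₁ Δ₂ ∧ Δ₁ ∪ Δ₂ = Set.univ ∧ v ∈ Δ₁ ∧ w ∈ Δ₂) ∧
      -- `Gp = G⁺` is the index two subgroup that fixes the halves setwise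
      (Gp.index = 2 ∧ Gp = MulAction.stabilizer G Δ₁ ∧ Gp = MulAction.stabilizer G Δ₂) ∧
      -- it is faithful on each half
      (∀ g ∈ Gp, (∀ x ∈ Δ₁, g • x = x) → g = 1) ∧
      (∀ g ∈ Gp, (∀ x ∈ Δ₂, g • x = x) → g = 1) ∧
      -- `N_v` and `N_w` are products of full strips
      (IsNontrivialPartition P₁ ∧ (∀ g ∈ Gp, CarriesPartition φ g P₁ P₁) ∧
        IsProductOfFullStrips (stabilizerImage φ v) P₁) ∧
      (IsNontrivialPartition P₂ ∧ (∀ g ∈ Gp, CarriesPartition φ g P₂ P₂) ∧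
        IsProductOfFullStrips (stabilizerImage φ w) P₂) ∧
      -- the join, and the interchange by `G`
      P₁ ⊔ P₂ = P ∧
      (∀ g, g ∉ Gp → CarriesPartition φ g P₁ P₂ ∧ CarriesPartition φ g P₂ P₁) ∧
      -- the construction applies to `G`, `P₁`, `P₂`, and every way to carry it out yields `Γ`
      IsConstructionInput φ e Gp P₁ P₂ ∧
      (∃ α g, IsConstructionChoice φ e Gp (P₁ ⊔ P₂) α g) ∧
      ∀ α g, IsConstructionChoice φ e Gp (P₁ ⊔ P₂) α g →
        IsCosetGraphPair (constructionSubgroup (changeCoordinates φ α) P₁) g ∧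
        Nonempty (Γ ≃g cosetGraph (constructionSubgroup (changeCoordinates φ α) P₁) g) := by
  have hQ : IsQuasiprimitiveWithSocle Γ.edgeSet φ := htype.elim And.left And.left
  have hT := hQ.nonabelian
  have : IsSimpleGroup T := hQ.simple
  have : FaithfulSMul G Γ.edgeSet := hQ.faithful
  have : MulAction.IsQuasiPreprimitive G Γ.edgeSet := hQ.quasiprimitive
  have hNn : N.Normal := hQ.unique_minimal.1.prop.1
  have hquasi : ∀ M : Subgroup G, M.Normal → M ≠ ⊥ → MulAction.IsPretransitive M Γ.edgeSet :=
    fun M => isPretransitive_of_ne_bot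
  have htr : MulAction.IsPretransitive N Γ.edgeSet := hquasi N hNn hQ.unique_minimal.1.prop.2
  have hiso := hconn.exists_adj hvw
  -- coordinates in which the stabilisers are products of straight strips
  have hcoord (β : Fin k → (T ≃* T))
      (h : stabilizerImage (changeCoordinates φ β) e = straightStrips T P) :
      ∃ P₁ P₂, stabilizerImage (changeCoordinates φ β) v = straightStrips T P₁ ∧
        stabilizerImage (changeCoordinates φ β) w = straightStrips T P₂ := by
    have hle := straightStrips_le_stabilizerImage hT he h
    obtain ⟨P₁, h₁⟩ := exists_eq_straightStrips hT fun t =>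
      (hle (const_mem_straightStrips P t)).1
    obtain ⟨P₂, h₂⟩ := exists_eq_straightStrips hT fun t =>
      (hle (const_mem_straightStrips P t)).2
    exact ⟨P₁, P₂, h₁, h₂⟩
  obtain ⟨α₀, hα₀⟩ := hP.exists_straight
  rw [← stabilizerImage_changeCoordinates] at hα₀
  obtain ⟨P₁, P₂, h₁, h₂⟩ := hcoord α₀ hα₀
  have hcarry {g : G} {Q R : Setoid (Fin k)} :
      CarriesPartition (changeCoordinates φ α₀) g Q R → CarriesPartition φ g Q R :=
    carriesPartition_changeCoordinates.1
  have hstab_ne : stabilizerImage (changeCoordinates φ α₀) v ≠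
      stabilizerImage (changeCoordinates φ α₀) w := by
    refine stabilizerImage_ne_of_adj hconn htr hvw fun h => ?_
    obtain ⟨t, ht⟩ := exists_ne (1 : T)
    have hm : (fun _ => t : Fin k → T) ∈ straightStrips T P₁ := const_mem_straightStrips P₁ t
    rw [← h₁, h, Subgroup.mem_bot] at hm
    exact ht (congrFun hm ⟨0, by have := hQ.two_le; omega⟩)
  have hne : P₁ ≠ P₂ := fun h => hstab_ne (by rw [h₁, h₂, h])
  have hsup : P₁ ⊔ P₂ = P := by
    refine straightStrips_injective (T := T) ?_
    rw [← straightStrips_inf]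
    refine le_antisymm (fun x hx => ?_) (by
      rw [← h₁, ← h₂]
      exact straightStrips_le_stabilizerImage hT he hα₀)
    rw [← h₁, ← h₂, Subgroup.mem_inf, mem_stabilizerImage, mem_stabilizerImage] at hx
    rw [← hα₀, mem_stabilizerImage, smul_edge_eq_iff _ he he]
    exact Or.inl hx
  -- the halves
  have hnot (n : G) (hn : n ∈ N) : n • v ≠ w := fun h => hne <|
    -- `n` fixes every partition, but moving `v` to `w` carries `P₁` to `P₂`.
    (carriesPartition_of_mem hn P₁).unique (carriesPartition_of_smul_eq hT h h₁ h₂)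
  let A : Set V := {x | ∃ n ∈ N, x = n • v}
  let B : Set V := {x | ∃ n ∈ N, x = n • w}
  have hvA : v ∈ A := ⟨1, N.one_mem, (one_smul _ _).symm⟩
  have hwB : w ∈ B := ⟨1, N.one_mem, (one_smul _ _).symm⟩
  have hdisj : Disjoint A B := by
    rw [Set.disjoint_left]
    rintro _ ⟨n, hn, rfl⟩ ⟨m, hm, h⟩
    refine hnot (m⁻¹ * n) (N.mul_mem (N.inv_mem hm) hn) ?_
    rw [mul_smul, h, inv_smul_smul]
  have hmem_adj ⦃x y : V⦄ (hxy : Γ.Adj x y) : x ∈ A ∧ y ∈ B ∨ x ∈ B ∧ y ∈ A := by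
    obtain ⟨n, hn, h⟩ := exists_smul_eq_of_adj htr hxy hvw
    exact h.imp (fun h => ⟨⟨n, hn, h.1.symm⟩, n, hn, h.2.symm⟩)
      fun h => ⟨⟨n, hn, h.2.symm⟩, n, hn, h.1.symm⟩
  have hbip : Γ.IsBipartiteWith A B := ⟨hdisj, hmem_adj⟩
  have hun : A ∪ B = Set.univ := by
    refine Set.eq_univ_of_forall fun x => ?_
    obtain ⟨y, hxy⟩ := hiso x
    exact (hmem_adj hxy).imp And.left And.left
  have hsmul {C : Set V} {a b : V} (hC : C = {x | ∃ n ∈ N, x = n • a}) {g : G} {n : G}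
      (hn : n ∈ N) (hg : g • a = n • b) : g • C = {x | ∃ n ∈ N, x = n • b} := by
    subst hC
    ext x
    constructor
    · rintro ⟨_, ⟨m, hm, rfl⟩, rfl⟩
      refine ⟨g * m * g⁻¹ * n, N.mul_mem (hNn.conj_mem m hm g) hn, ?_⟩
      change g • m • a = _
      rw [mul_smul, ← hg, mul_smul, inv_smul_smul, mul_smul]
    · rintro ⟨m, hm, rfl⟩
      refine ⟨(g⁻¹ * (m * n⁻¹) * g) • a, ⟨_, ?_, rfl⟩, ?_⟩
      · simpa using hNn.conj_mem _ (N.mul_mem hm (N.inv_mem hn)) g⁻¹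
      · change g • _ = _
        rw [mul_smul, hg, mul_smul, smul_inv_smul, mul_smul, inv_smul_smul]
  have hcases (g : G) : ((∃ n ∈ N, g • v = n • v) ∧ ∃ n ∈ N, g • w = n • w) ∨
      (∃ n ∈ N, g • v = n • w) ∧ ∃ n ∈ N, g • w = n • v :=
    hmem_adj ((adj_smul_iff g v w).2 hvw)
  have hAB : A ≠ B := fun h => Set.disjoint_left.1 hdisj hvA (h ▸ hvA)
  have hG (g : G) : g • A = A ∧ g • B = B ∨ g • A = B ∧ g • B = A := by
    rcases hcases g with ⟨⟨n, hn, h⟩, m, hm, h'⟩ | ⟨⟨n, hn, h⟩, m, hm, h'⟩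
    · exact Or.inl ⟨hsmul rfl hn h, hsmul rfl hm h'⟩
    · exact Or.inr ⟨hsmul rfl hn h, hsmul rfl hm h'⟩
  have hGp {g : G} (hg : g ∈ MulAction.stabilizer G A) :
      (∃ n ∈ N, g • v = n • v) ∧ ∃ n ∈ N, g • w = n • w := by
    refine (hcases g).resolve_right ?_
    rintro ⟨⟨n, hn, h⟩, -⟩
    exact hAB (hg.symm.trans (hsmul rfl hn h))
  have hGp' {g : G} (hg : g ∉ MulAction.stabilizer G A) :
      (∃ n ∈ N, g • v = n • w) ∧ ∃ n ∈ N, g • w = n • v := by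
    refine (hcases g).resolve_left ?_
    rintro ⟨⟨n, hn, h⟩, -⟩
    exact hg (hsmul rfl hn h)
  have hN_le : N ≤ MulAction.stabilizer G A := fun n hn => hsmul rfl hn rfl
  have hstabAB : MulAction.stabilizer G A = MulAction.stabilizer G B := by
    ext g
    rw [MulAction.mem_stabilizer_iff, MulAction.mem_stabilizer_iff]
    rcases hG g with ⟨h, h'⟩ | ⟨h, h'⟩
    · exact iff_of_true h h'
    · exact iff_of_false (fun h'' => hAB (h''.symm.trans h)) fun h'' => hAB (h'.symm.trans h'')
  -- an element that swaps the ends of the edge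
  obtain ⟨g₀, hg₀e, hg₀⟩ : ∃ g ∈ MulAction.stabilizer G e, g ∉ MulAction.stabilizer G A := by
    obtain ⟨h, hh⟩ := MulAction.exists_smul_eq G v w
    -- `N` is edge-transitive and preserves the halves, so `h` can be corrected to fix `e` while
    -- still exchanging them.
    obtain ⟨n, hn⟩ := htr.exists_smul_eq (h • e) e
    refine ⟨n * h, (mul_smul _ _ _).trans hn, fun hm => ?_⟩
    obtain ⟨⟨m, hm, hm'⟩, -⟩ := hGp ((Subgroup.mul_mem_cancel_left _ (hN_le n.2)).1 hm)
    exact hnot m hm (hm'.symm.trans hh)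
  have hswap {g : G} (hge : g ∈ MulAction.stabilizer G e) (hg : g ∉ MulAction.stabilizer G A) :
      g • v = w ∧ g • w = v := by
    refine ((smul_edge_eq_iff g he he).1 hge).resolve_left fun h => hg ?_
    exact hsmul rfl N.one_mem (h.1.trans (one_smul _ _).symm)
  have hindex : (MulAction.stabilizer G A).index = 2 := by
    rw [Subgroup.index_eq_two_iff_exists_notMem_and]
    refine ⟨g₀, hg₀, fun b => or_iff_not_imp_right.2 fun hb => ?_⟩
    have hb' := ((hG b).resolve_left fun h => hb h.1).2
    have hg' := ((hG g₀).resolve_left fun h => hg₀ h.1).1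
    rw [MulAction.mem_stabilizer_iff, mul_smul, hg', hb']
  -- the action on the partitions
  have hcarries {a b : V} {Q R : Setoid (Fin k)}
      (ha : stabilizerImage (changeCoordinates φ α₀) a = straightStrips T Q)
      (hb : stabilizerImage (changeCoordinates φ α₀) b = straightStrips T R) {g : G}
      (h : ∃ n ∈ N, g • a = n • b) : CarriesPartition φ g Q R := by
    obtain ⟨n, hn, h⟩ := h
    have h' : (n⁻¹ * g) • a = b := by rw [mul_smul, h, inv_smul_smul]
    have := (carriesPartition_of_smul_eq hT h' ha hb).mul (carriesPartition_of_mem hn R)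
    rw [mul_inv_cancel_left] at this
    exact hcarry this
  have hinv₁ (g : G) (hg : g ∈ MulAction.stabilizer G A) : CarriesPartition φ g P₁ P₁ :=
    hcarries h₁ h₁ (hGp hg).1
  have hinv₂ (g : G) (hg : g ∈ MulAction.stabilizer G A) : CarriesPartition φ g P₂ P₂ :=
    hcarries h₂ h₂ (hGp hg).2
  have hinter (g : G) (hg : g ∉ MulAction.stabilizer G A) :
      CarriesPartition φ g P₁ P₂ ∧ CarriesPartition φ g P₂ P₁ :=
    ⟨hcarries h₁ h₂ (hGp' hg).1, hcarries h₂ h₁ (hGp' hg).2⟩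
  have hnontriv {Q R : Setoid (Fin k)} (hQR : CarriesPartition φ g₀ Q R) (h : Q ≠ R) :
      IsNontrivialPartition Q :=
    ⟨by rintro rfl; exact h hQR.eq_bot.symm, by rintro rfl; exact h hQR.eq_top.symm⟩
  rw [stabilizerImage_changeCoordinates] at h₁ h₂ hα₀
  refine ⟨A, B, MulAction.stabilizer G A, P₁, P₂, ⟨hbip, hun, hvA, hwB⟩, ⟨hindex, rfl, hstabAB⟩,
    fun g _ hg => eq_one_of_fixes_half hcb hquasi hbip hun hvw hvA hwB hiso hG hg,
    fun g _ hg => eq_one_of_fixes_half hcb hquasi hbip.symm (Set.union_comm A B ▸ hun) hvw.symm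
      hwB hvA hiso (fun g => (hG g).imp And.symm And.symm) hg,
    ⟨hnontriv (hinter g₀ hg₀).1 hne, hinv₁, isProductOfFullStrips_of_straight h₁⟩,
    ⟨hnontriv (hinter g₀ hg₀).2 hne.symm, hinv₂, isProductOfFullStrips_of_straight h₂⟩,
    hsup, hinter, ⟨htype, hindex, hne, hinv₁, hinv₂, hinter, hsup.symm ▸ hP⟩,
    ⟨α₀, g₀, by rw [stabilizerImage_changeCoordinates, hsup, hα₀], hg₀e, hg₀⟩, ?_⟩
  -- the coset graph
  rintro α g ⟨hstr, hge, hg⟩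
  obtain ⟨hgv, hgw⟩ := hswap hge hg
  rw [hsup] at hstr
  -- The coordinates `α` are arbitrary here and may differ from `α₀`; the partition they give for
  -- `v` is nevertheless `P₁`.
  obtain ⟨Q, -, hQv, -⟩ := hcoord α hstr
  obtain rfl : P₁ = Q := by
    rw [stabilizerImage_changeCoordinates] at hQv
    exact eq_of_map_eq_straightStrips h₁ hQv
  have hH : constructionSubgroup (changeCoordinates φ α) P₁ = MulAction.stabilizer G v := by
    refine constructionSubgroup_eq_stabilizer hT hQv fun h hh => ?_
    -- An element outside `G⁺` carries `P₁` to `P₂ ≠ P₁`.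
    by_contra hcon
    have hh' : h ∉ MulAction.stabilizer G A := fun h' => hcon (hGp h').1
    exact hne ((carriesPartition_changeCoordinates.1 hh).unique (hinter h hh').1)
  rw [hH]
  refine ⟨⟨?_, fun hnorm => hstab_ne ?_, ?_⟩, nonempty_iso_cosetGraph hvw hgv fun u hu => ?_⟩
  · refine (Subgroup.eq_bot_iff_forall _).2 fun x hx => eq_one_of_forall_smul_eq fun u => ?_
    obtain ⟨y, rfl⟩ := MulAction.exists_smul_eq G v u
    have h := hx y⁻¹
    rw [inv_inv] at h
    have h' : (y⁻¹ * x * y) • v = v := h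
    rwa [mul_smul, mul_smul, inv_smul_eq_iff] at h'
  -- As `g` swaps `v` and `w`, normalising `G_v` would give `N_v = N_w`.
  · ext x
    have h := Subgroup.mem_normalizer_iff.1 hnorm ((changeCoordinates φ α₀).symm x : G)
    rw [mem_stabilizerImage, mem_stabilizerImage]
    rw [MulAction.mem_stabilizer_iff, MulAction.mem_stabilizer_iff, mul_smul, mul_smul,
      inv_smul_eq_iff.2 hgw.symm, smul_eq_iff_eq_inv_smul g, inv_smul_eq_iff.2 hgw.symm] at h
    exact h
  · change g ^ 2 • v = v
    rw [pow_two, mul_smul, hgv, hgw]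
  · obtain ⟨n, hn, h | h⟩ := exists_smul_eq_of_adj htr hu hvw
    · exact ⟨n, h.1, h.2⟩
    -- Here `n` takes `w` to `v`, although they lie in different `N`-orbits.
    · exact absurd (inv_smul_eq_iff.2 h.2.symm) (hnot n⁻¹ (N.inv_mem hn))
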